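/- Let $0<m\le L$, $\kappa=L/m$, and let $\mathcal S^2_{m,L}$ be the class of functions $f:\mathbb R^d\to\mathbb R$ ($d$ arbitrary) that are $m$-strongly convex, have an $L$-Lipschitz gradient, and are twice continuously differentiable. Let $\rho\in(0,1)$ satisfy $$\rho=\frac{\sqrt\kappa-1}{\sqrt\kappa+1}\ \text{ if }\kappa<9+4\sqrt5,\qquad \rho\in\Bigl(\rho_{\mathrm{C2M}},\,1-\sqrt{2/\kappa}\,\Bigr]\ \text{ if }\kappa\ge 9+4\sqrt5,$$ where $\rho_{\mathrm{C2M}}$ is the smallest positive root $\rho$ of $$\begin{aligned}p(\kappa,\rho)={}&8\kappa(\kappa+1)\rho^7-(23\kappa^2+18\kappa+7)\rho^6+2(5\kappa^2-14\kappa-7)\rho^5+(31\kappa^2+50\kappa+15)\rho^4\\&-4(11\kappa^2-4\kappa-11)\rho^3+(23\kappa^2-30\kappa+23)\rho^2-2(\kappa-1)(3\kappa+1)\rho+(\kappa-1)^2.\end{aligned}$$ (Since $\rho>0$, this forces $\kappa>1$.) The C2M method with these parameters is the iteration $$x_{k+1}=x_k+\beta(x_k-x_{k-1})-\alpha\nabla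 f\bigl(x_k+\eta(x_k-x_{k-1})\bigr),\qquad k\ge0,$$ with arbitrary initial conditions $x_{-1},x_0\in\mathbb R^d$ and $$\alpha=\frac{(1-\rho)^2}{m},\qquad \beta=\frac{\rho}{\kappa-1}\Bigl(1-\frac{\kappa(1-3\rho)}{1+\rho}\Bigr),\qquad \eta=\frac{\rho}{\kappa-1}\Bigl(\frac{1+\rho}{(1-\rho)^2}-\frac{\kappa}{1+\rho}\Bigr).$$ Then: 1. Every $f\in\mathcal S^2_{m,L}$ has a unique minimizer $x_\star$, and for all initial conditions $x_{-1},x_0\in\mathbb R^d$ the C2M iterates $x_k$ converge to $x_\star$. 2. The worst-case root-convergence factor of C2M over $\mathcal S^2_{m,L}$, i.e. the supremum of $\limsup_{k\to\infty}\|x_k-x_\star\|^{1/k}$ over all $f\in\mathcal S^2_{m,L}$ and all initial conditions, is at most $\rho$. -/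

import Mathlib

open Filter Topology
open scoped ENNReal Gradient

noncomputable section

/-- The class of `m`-strongly convex functions on `ℝᵈ` that have an `L`-Lipschitz gradient and are
twice continuously differentiable. -/
structure SmoothStronglyConvexC2 {d : ℕ} (m L : ℝ) (f : EuclideanSpace ℝ (Fin d) → ℝ) : Prop where
  contDiff : ContDiff ℝ 2 f
  strongConvex : StrongConvexOn Set.univ m f
  lipschitz_gradient : ∀ x y, ‖∇ f x - ∇ f y‖ ≤ L * ‖x - y‖

/-- One step of the momentum iteration: from `x = x_k` and `xprev = x_{k-1}` it computes `x_{k+1}`,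
the gradient being evaluated at `y_k = x_k + η (x_k - x_{k-1})`. -/
def momentumStep {d : ℕ} (α β η : ℝ) (f : EuclideanSpace ℝ (Fin d) → ℝ)
    (x xprev : EuclideanSpace ℝ (Fin d)) : EuclideanSpace ℝ (Fin d) :=
  x + β • (x - xprev) - α • ∇ f (x + η • (x - xprev))

/-- The iterates `x_0, x_1, x_2, …` of the momentum iteration with initial conditions
`xinit = x_{-1}` and `x0 = x_0`. -/
def momentumIterates {d : ℕ} (α β η : ℝ) (f : EuclideanSpace ℝ (Fin d) → ℝ)
    (xinit x0 : EuclideanSpace ℝ (Fin d)) : ℕ → EuclideanSpace ℝ (Fin d)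
  | 0 => x0
  | 1 => momentumStep α β η f x0 xinit
  | k + 2 => momentumStep α β η f (momentumIterates α β η f xinit x0 (k + 1))
      (momentumIterates α β η f xinit x0 k)

/-- The root-convergence factor `limsup ‖x_k - x⋆‖^{1/k}` of a sequence with limit `x⋆`, as an
extended nonnegative real, so that the limsup always exists. -/
def rootConvergenceFactor {E : Type*} [NormedAddCommGroup E] (x : ℕ → E) (xstar : E) : ℝ≥0∞ :=
  limsup (fun k : ℕ => ‖x k - xstar‖ₑ ^ (1 / (k : ℝ))) atTop

/-- The supremum of the root-convergence factors over all convergent sequences that the momentum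
iteration produces on a function of the class `F`. -/
def worstCaseRootConvergenceFactor {d : ℕ} (α β η : ℝ)
    (F : Set (EuclideanSpace ℝ (Fin d) → ℝ)) : ℝ≥0∞ :=
  sSup {r | ∃ f ∈ F, ∃ xinit x0 xstar : EuclideanSpace ℝ (Fin d),
    Tendsto (momentumIterates α β η f xinit x0) atTop (𝓝 xstar) ∧
      r = rootConvergenceFactor (momentumIterates α β η f xinit x0) xstar}

def c2mAlpha (m ρ : ℝ) : ℝ := (1 - ρ) ^ 2 / m

def c2mBeta (κ ρ : ℝ) : ℝ := ρ / (κ - 1) * (1 - κ * (1 - 3 * ρ) / (1 + ρ))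

def c2mEta (κ ρ : ℝ) : ℝ := ρ / (κ - 1) * ((1 + ρ) / (1 - ρ) ^ 2 - κ / (1 + ρ))

def c2mPoly (κ ρ : ℝ) : ℝ :=
  8 * κ * (κ + 1) * ρ ^ 7
    - (23 * κ ^ 2 + 18 * κ + 7) * ρ ^ 6
    + 2 * (5 * κ ^ 2 - 14 * κ - 7) * ρ ^ 5
    + (31 * κ ^ 2 + 50 * κ + 15) * ρ ^ 4
    - 4 * (11 * κ ^ 2 - 4 * κ - 11) * ρ ^ 3
    + (23 * κ ^ 2 - 30 * κ + 23) * ρ ^ 2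
    - 2 * (κ - 1) * (3 * κ + 1) * ρ
    + (κ - 1) ^ 2

/-- The smallest positive root of `c2mPoly κ`; see `isLeast_rhoC2M` for its existence. -/
def rhoC2M (κ : ℝ) : ℝ := sInf {r | 0 < r ∧ c2mPoly κ r = 0}

/-- The admissible choices of the parameter `ρ` for the condition number `κ`. -/
def IsC2MParameter (κ ρ : ℝ) : Prop :=
  (κ < 9 + 4 * √5 → ρ = (√κ - 1) / (√κ + 1)) ∧
    (9 + 4 * √5 ≤ κ → ρ ∈ Set.Ioc (rhoC2M κ) (1 - √(2 / κ)))

/-- `rhoC2M κ` is indeed the smallest positive root, and the interval of admissible parameters is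
nonempty. -/
theorem isLeast_rhoC2M {κ : ℝ} (hκ : 9 + 4 * √5 ≤ κ) :
    IsLeast {r | 0 < r ∧ c2mPoly κ r = 0} (rhoC2M κ) ∧ rhoC2M κ < 1 - √(2 / κ) := by
  have h5 : (2 : ℝ) < √5 := by
    rw [Real.lt_sqrt (by norm_num)]; norm_num
  have hκ17 : (17 : ℝ) < κ := by linarith
  have hκ0 : (0 : ℝ) < κ := by linarith
  obtain ⟨s, hs⟩ : ∃ s, s = √(2 / κ) := ⟨_, rfl⟩
  have hs0 : 0 < s := by rw [hs]; positivity
  have hs2 : s ^ 2 = 2 / κ := by rw [hs, Real.sq_sqrt (by positivity)]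
  have hκs : κ = 2 / s ^ 2 := by rw [hs2]; field_simp
  have hs3 : s < 7 / 20 := by
    have : s ^ 2 < (7 / 20) ^ 2 := by
      rw [hs2, div_lt_iff₀ hκ0]; linarith
    exact lt_of_pow_lt_pow_left₀ 2 (by norm_num) this
  have hval : c2mPoly κ (1 - s)
      = s ^ 2 * (-28 + 80 * s - 84 * s ^ 2 + 40 * s ^ 3 - 7 * s ^ 4) := by
    rw [hκs]; unfold c2mPoly; field_simp; ring
  have hneg : c2mPoly κ (1 - s) < 0 := by
    rw [hval]
    apply mul_neg_of_pos_of_neg (by positivity)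
    nlinarith [sq_nonneg (s - 7 / 20), pow_pos hs0 2, pow_pos hs0 3, pow_pos hs0 4,
      mul_pos (pow_pos hs0 2) (sub_pos.2 hs3)]
  have hpos : 0 < c2mPoly κ 0 := by
    have : c2mPoly κ 0 = (κ - 1) ^ 2 := by unfold c2mPoly; ring
    rw [this]; exact pow_pos (by linarith) 2
  have hcont : Continuous (c2mPoly κ) := by unfold c2mPoly; fun_prop
  obtain ⟨r, hr, hr0⟩ := intermediate_value_Icc' (by linarith : (0 : ℝ) ≤ 1 - s)
    hcont.continuousOn ⟨hneg.le, hpos.le⟩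
  have hrmem : r ∈ {r | 0 < r ∧ c2mPoly κ r = 0} := by
    refine ⟨lt_of_le_of_ne hr.1 ?_, hr0⟩
    rintro rfl
    exact hpos.ne' hr0
  have hrlt : r < 1 - s := by
    refine lt_of_le_of_ne hr.2 ?_
    rintro rfl
    exact hneg.ne hr0
  have hset : {r | 0 < r ∧ c2mPoly κ r = 0} = Set.Ici 0 ∩ c2mPoly κ ⁻¹' {0} := by
    ext t
    constructor
    · rintro ⟨h1, h2⟩
      exact ⟨h1.le, h2⟩
    · rintro ⟨h1, h2⟩
      refine ⟨lt_of_le_of_ne h1 ?_, h2⟩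
      rintro rfl
      exact hpos.ne' h2
  have hclosed : IsClosed {r | 0 < r ∧ c2mPoly κ r = 0} := by
    rw [hset]
    exact isClosed_Ici.inter (isClosed_singleton.preimage hcont)
  have hbdd : BddBelow {r | 0 < r ∧ c2mPoly κ r = 0} := ⟨0, fun t ht => ht.1.le⟩
  refine ⟨⟨hclosed.csInf_mem ⟨r, hrmem⟩ hbdd, fun t ht => csInf_le hbdd ht⟩, ?_⟩
  rw [← hs]
  exact (csInf_le hbdd hrmem).trans_lt hrlt

end

/-! Two separate arguments are combined: a global Lyapunov function gives convergence without a
rate, and linearization at the minimizer then gives the rate.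

For curvature `q`, the trace and determinant of the iteration are affine in `q`. The parameters
place a double root `ρ` at `q = m` and the roots `-ρ`, `-c` at `q = L`, where `c = c2mRoot κ ρ`. If
`0 < c ≤ ρ`, all intermediate roots stay in the disc of radius `ρ` (`jury_of_endpoints`). Since `f`
is C², the Hessian at the minimizer diagonalizes the dynamics up to `o(‖e‖)`, and every `σ > ρ` is a
local rate (`eventually_norm_le_mul_pow`).

Global convergence (`tendsto_of_recurrence`) treats the gradient as a monotone nonlinearity.
Interpolation between consecutive query points bounds the growth of a nonnegative function of the
state by a supply rate, and this supply is, up to squares, the decrease of a quadratic storage. The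
squares leave a strict decrease exactly when `c2mDisc ρ c < 0`.

Up to the factor `(1 + ρ) ^ 2`, `c2mPoly` is this discriminant. `IsC2MParameter.root_bounds` derives
both conditions on `c` from the admissible range of `ρ`. -/

/-! ### Algebra of the parameters at the two extreme curvatures. -/

/-- Minus the second root of the characteristic polynomial of the C2M method at curvature `L`; the
first root is `-ρ`. -/
noncomputable def c2mRoot (κ ρ : ℝ) : ℝ := κ * (1 - ρ) ^ 2 / (1 + ρ) - 1

/-- Discriminant of the frequency-domain stability condition. -/
def c2mDisc (ρ c : ℝ) : ℝ :=
  (1 - 2 * ρ + 9 * ρ ^ 2 + 8 * ρ ^ 3) * c ^ 2 - 2 * ρ * (1 - ρ) * (1 + 7 * ρ + 4 * ρ ^ 2) * c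
    + ρ ^ 2 * (1 - ρ) ^ 2

theorem c2mPoly_eq_mul_c2mDisc {κ ρ : ℝ} (h : 1 + ρ ≠ 0) :
    c2mPoly κ ρ = (1 + ρ) ^ 2 * c2mDisc ρ (c2mRoot κ ρ) := by
  unfold c2mPoly c2mDisc c2mRoot
  field_simp
  ring

theorem c2m_det_left {κ ρ : ℝ} (hκ : κ ≠ 1) (h0 : 1 + ρ ≠ 0) (h1 : 1 - ρ ≠ 0) :
    c2mBeta κ ρ - (1 - ρ) ^ 2 * c2mEta κ ρ = ρ ^ 2 := by
  have := sub_ne_zero.2 hκ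
  unfold c2mBeta c2mEta
  field_simp
  ring

theorem c2m_trace_left {κ ρ : ℝ} (hκ : κ ≠ 1) (h0 : 1 + ρ ≠ 0) (h1 : 1 - ρ ≠ 0) :
    1 + c2mBeta κ ρ - (1 - ρ) ^ 2 * (1 + c2mEta κ ρ) = 2 * ρ := by
  linear_combination c2m_det_left hκ h0 h1

theorem c2m_det_right {κ ρ : ℝ} (hκ : κ ≠ 1) (h0 : 1 + ρ ≠ 0) (h1 : 1 - ρ ≠ 0) :
    c2mBeta κ ρ - κ * (1 - ρ) ^ 2 * c2mEta κ ρ = ρ * c2mRoot κ ρ := by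
  have := sub_ne_zero.2 hκ
  unfold c2mBeta c2mEta c2mRoot
  field_simp
  ring

theorem c2m_trace_right {κ ρ : ℝ} (hκ : κ ≠ 1) (h0 : 1 + ρ ≠ 0) (h1 : 1 - ρ ≠ 0) :
    1 + c2mBeta κ ρ - κ * (1 - ρ) ^ 2 * (1 + c2mEta κ ρ) = -(ρ + c2mRoot κ ρ) := by
  have h : (1 + ρ) * c2mRoot κ ρ = κ * (1 - ρ) ^ 2 - (1 + ρ) := by
    unfold c2mRoot
    field_simp
  linear_combination c2m_det_right hκ h0 h1 + h

/-! ### Sign of the defining polynomial beyond its smallest positive root. -/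

/-- The larger root in `c / (1 - ρ)` of the discriminant, shifted, as a function of
`w = √((1 + ρ) / ρ)`. -/
noncomputable def c2mThreshold (w : ℝ) : ℝ :=
  (w + 1) / (w ^ 3 - 3 * w ^ 2 + 2 * w + 2) + 1 / (w ^ 2 - 2)

theorem one_lt_cubic {w : ℝ} (hw0 : 0 < w) (hw : 2 < w ^ 2) :
    1 < w ^ 3 - 3 * w ^ 2 + 2 * w + 2 := by
  have h1 : 1 < w := by nlinarith
  nlinarith [mul_nonneg (sub_nonneg.2 h1.le) (sq_nonneg (w - 3 / 2)), sq_nonneg (w - 3 / 2)]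

theorem c2mThreshold_lt {v w : ℝ} (hv0 : 0 < v) (hv : 2 < v ^ 2) (hvw : v < w) :
    c2mThreshold w < c2mThreshold v := by
  have hw0 : 0 < w := hv0.trans hvw
  have hw : 2 < w ^ 2 := by nlinarith
  have hqv := one_lt_cubic hv0 hv
  have hqw := one_lt_cubic hw0 hw
  have hv2 : 0 < v ^ 2 - 2 := by linarith
  have hw2 : 0 < w ^ 2 - 2 := by linarith
  set qv := v ^ 3 - 3 * v ^ 2 + 2 * v + 2 with hqv'
  set qw := w ^ 3 - 3 * w ^ 2 + 2 * w + 2 with hqw'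
  have hvw0 : 0 < v * w := mul_pos hv0 hw0
  -- For `v * w ≥ 3` the left side is nonpositive. Otherwise `2 < v * w < 3`, and both `(v * w - 2)
  -- ^ 2` and `3 - v * w` are below `1`, while `qv * qw > 1`.
  have key : (v ^ 2 - 2) * (w ^ 2 - 2) * (3 - v * w) < qv * qw := by
    have hqq : 1 < qv * qw := by nlinarith
    have hA : (v ^ 2 - 2) * (w ^ 2 - 2) ≤ (v * w - 2) ^ 2 := by nlinarith [sq_nonneg (v - w)]
    have hAp : 0 < (v ^ 2 - 2) * (w ^ 2 - 2) := mul_pos hv2 hw2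
    rcases le_or_gt 3 (v * w) with h | h
    · nlinarith
    · have h2 : 2 < v * w := by nlinarith
      have h3 : (v * w - 2) ^ 2 < 1 := by nlinarith
      nlinarith
  have e : c2mThreshold v - c2mThreshold w
      = (w - v) * (((v + w) * (qv * qw - (v ^ 2 - 2) * (w ^ 2 - 2) * (3 - v * w))
        + (v - w) ^ 2 * ((v ^ 2 - 2) * (w ^ 2 - 2))) / (qv * qw * ((v ^ 2 - 2) * (w ^ 2 - 2)))) := by
    unfold c2mThreshold
    rw [← hqv', ← hqw']
    have n1 : qv ≠ 0 := by positivity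
    have n2 : qw ≠ 0 := by positivity
    field_simp
    rw [hqv', hqw']
    ring
  have : 0 < c2mThreshold v - c2mThreshold w := by
    rw [e]
    have : 0 < qv * qw - (v ^ 2 - 2) * (w ^ 2 - 2) * (3 - v * w) := by linarith
    have : 0 < w - v := by linarith
    positivity
  linarith

/-- The reparametrization `w = √((1 + ρ) / ρ)` of the rate. -/
noncomputable def c2mW (ρ : ℝ) : ℝ := √((1 + ρ) / ρ)

theorem c2mW_pos {ρ : ℝ} (h0 : 0 < ρ) : 0 < c2mW ρ := by
  unfold c2mW
  positivity

theorem c2mW_sq {ρ : ℝ} (h0 : 0 < ρ) : c2mW ρ ^ 2 = (1 + ρ) / ρ :=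
  Real.sq_sqrt (by positivity)

theorem two_lt_c2mW_sq {ρ : ℝ} (h0 : 0 < ρ) (h1 : ρ < 1) : 2 < c2mW ρ ^ 2 := by
  rw [c2mW_sq h0, lt_div_iff₀ h0]
  linarith

theorem c2mW_lt {ρ r : ℝ} (h0 : 0 < ρ) (h : ρ < r) : c2mW r < c2mW ρ := by
  have hr : 0 < r := h0.trans h
  unfold c2mW
  apply Real.sqrt_lt_sqrt (by positivity)
  rw [div_lt_div_iff₀ hr h0]
  nlinarith

/-- As a quadratic in `e = c / (1 - ρ)`, the discriminant `c2mDisc` has quarter discriminant `16 ρ³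
(1 + ρ)³`, which is a square in terms of `w`; hence it splits into two linear factors. For `2 ≤ κ (1
- ρ)²` the factor with the smaller root is positive and goes into `C`, so the sign is that of the
other factor. -/
theorem c2mPoly_factor {κ ρ : ℝ} (h0 : 0 < ρ) (h1 : ρ < 1) :
    ∃ C, (2 ≤ κ * (1 - ρ) ^ 2 → 0 < C) ∧
      c2mPoly κ ρ = C * (κ * (1 - 2 / c2mW ρ ^ 2) - 1 - c2mThreshold (c2mW ρ)) := by
  obtain ⟨w, hw⟩ : ∃ w, w = c2mW ρ := ⟨_, rfl⟩
  have hw0 : 0 < w := hw ▸ c2mW_pos h0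
  have hw2 : 2 < w ^ 2 := hw ▸ two_lt_c2mW_sq h0 h1
  have hρ : ρ = 1 / (w ^ 2 - 1) := by
    rw [hw, c2mW_sq h0]
    field_simp
    ring
  have hq := one_lt_cubic hw0 hw2
  rw [← hw]
  have n1 : w ^ 2 - 1 ≠ 0 := by nlinarith
  have n2 : w ^ 2 - 2 ≠ 0 := by nlinarith
  set q := w ^ 3 - 3 * w ^ 2 + 2 * w + 2 with hq'
  have n3 : q ≠ 0 := by positivity
  set e := c2mRoot κ ρ / (1 - ρ) with he
  have hce : c2mRoot κ ρ = (1 - ρ) * e := by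
    have : 1 - ρ ≠ 0 := by linarith
    rw [he]; field_simp
  have hew : e = κ * (1 - 2 / w ^ 2) - 1 - 1 / (w ^ 2 - 2) := by
    rw [he, c2mRoot, hρ]
    have : 1 - 1 / (w ^ 2 - 1) = (w ^ 2 - 2) / (w ^ 2 - 1) := by field_simp; ring
    have h' : 1 + 1 / (w ^ 2 - 1) = w ^ 2 / (w ^ 2 - 1) := by field_simp; ring
    rw [this, h']
    field_simp
    ring
  refine ⟨(1 + ρ) ^ 2 * (1 - ρ) ^ 2 * ρ ^ 3 * ((w ^ 3 + 3 * w ^ 2 + 2 * w - 2) * e - (w - 1)) * q,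
    fun h => ?_, ?_⟩
  · have hρ1 : 0 < 1 - ρ := by linarith
    have hel : 1 / (1 + ρ) ≤ e := by
      rw [he, le_div_iff₀ hρ1, c2mRoot, div_mul_eq_mul_div, le_sub_iff_add_le,
        div_add_one (by positivity), div_le_div_iff_of_pos_right (by positivity)]
      linarith
    have hel2 : 1 / 2 < e := by
      refine lt_of_lt_of_le ?_ hel
      rw [div_lt_div_iff₀ (by norm_num) (by linarith)]
      linarith
    have hw1 : 1 < w := by nlinarith
    have : 0 < (w ^ 3 + 3 * w ^ 2 + 2 * w - 2) * e - (w - 1) := by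
      have : 0 < w ^ 3 + 3 * w ^ 2 + 2 * w - 2 := by nlinarith [pow_pos hw0 3]
      nlinarith [pow_pos hw0 3]
    positivity
  · rw [c2mPoly_eq_mul_c2mDisc (by linarith)]
    have hD : c2mDisc ρ (c2mRoot κ ρ) = (1 - ρ) ^ 2 * ρ ^ 3 *
        ((w ^ 3 + 3 * w ^ 2 + 2 * w - 2) * e - (w - 1)) * (q * e - (w + 1)) := by
      rw [hce]
      have hquad : (1 - 2 * ρ + 9 * ρ ^ 2 + 8 * ρ ^ 3) * e ^ 2
          - 2 * ρ * (1 + 7 * ρ + 4 * ρ ^ 2) * e + ρ ^ 2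
          = ρ ^ 3 * ((w ^ 3 + 3 * w ^ 2 + 2 * w - 2) * e - (w - 1)) * (q * e - (w + 1)) := by
        rw [hρ, hq']
        field_simp
        ring
      unfold c2mDisc
      linear_combination (1 - ρ) ^ 2 * hquad
    have hT : q * (κ * (1 - 2 / w ^ 2) - 1 - c2mThreshold w) = q * e - (w + 1) := by
      rw [hew, c2mThreshold, ← hq']
      field_simp
      ring
    rw [hD]
    linear_combination (-((1 + ρ) ^ 2 * (1 - ρ) ^ 2 * ρ ^ 3 *
      ((w ^ 3 + 3 * w ^ 2 + 2 * w - 2) * e - (w - 1)))) * hT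

theorem two_le_mul_sq_of_le {κ ρ : ℝ} (hκ : 0 < κ) (h : ρ ≤ 1 - √(2 / κ)) :
    2 ≤ κ * (1 - ρ) ^ 2 := by
  have h1 : √(2 / κ) ≤ 1 - ρ := by linarith
  have h2 : √(2 / κ) ^ 2 ≤ (1 - ρ) ^ 2 := pow_le_pow_left₀ (Real.sqrt_nonneg _) h1 2
  rw [Real.sq_sqrt (by positivity), div_le_iff₀ hκ] at h2
  linarith

/-- `w` decreases in `ρ`, and the gap increases in `w`, as the threshold decreases. The gap can
therefore change sign only once. -/
theorem c2m_gap_lt {κ ρ r : ℝ} (hκ : 0 < κ) (h0 : 0 < ρ) (h : ρ < r) (h1 : r < 1) :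
    κ * (1 - 2 / c2mW r ^ 2) - 1 - c2mThreshold (c2mW r)
      < κ * (1 - 2 / c2mW ρ ^ 2) - 1 - c2mThreshold (c2mW ρ) := by
  have hr := h0.trans h
  have a1 := c2mThreshold_lt (c2mW_pos hr) (two_lt_c2mW_sq hr h1) (c2mW_lt h0 h)
  have a2 : c2mW r ^ 2 < c2mW ρ ^ 2 := pow_lt_pow_left₀ (c2mW_lt h0 h) (c2mW_pos hr).le two_ne_zero
  have a3 : 2 / c2mW ρ ^ 2 < 2 / c2mW r ^ 2 :=
    div_lt_div_of_pos_left two_pos (pow_pos (c2mW_pos hr) 2) a2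
  nlinarith

theorem c2mPoly_neg {κ ρ : ℝ} (hκ : 9 + 4 * √5 ≤ κ) (hρ1 : ρ < 1)
    (h : ρ ∈ Set.Ioc (rhoC2M κ) (1 - √(2 / κ))) : c2mPoly κ ρ < 0 := by
  have hκ0 : 0 < κ := lt_of_lt_of_le (by positivity) hκ
  obtain ⟨⟨⟨hr0, hr⟩, -⟩, hr1⟩ := isLeast_rhoC2M hκ
  set r := rhoC2M κ
  have hr1' : r < 1 := h.1.trans hρ1
  obtain ⟨C, hC, e⟩ := c2mPoly_factor (κ := κ) hr0 hr1'
  obtain ⟨C', hC', e'⟩ := c2mPoly_factor (κ := κ) (hr0.trans h.1) hρ1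
  have c1 := hC (two_le_mul_sq_of_le hκ0 hr1.le)
  have c2 := hC' (two_le_mul_sq_of_le hκ0 h.2)
  have := c2m_gap_lt hκ0 hr0 h.1 hρ1
  rw [hr] at e
  have hz := (mul_eq_zero.1 e.symm).resolve_left c1.ne'
  rw [e']
  exact mul_neg_of_pos_of_neg c2 (by linarith)

/-! ### Admissible parameters satisfy `0 < c ≤ ρ` and have negative discriminant. -/

theorem c2mDisc_self (ρ : ℝ) : c2mDisc ρ ρ = 16 * ρ ^ 3 * (ρ ^ 2 + ρ - 1) := by
  unfold c2mDisc
  ring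

theorem c2mRoot_sqrt {κ : ℝ} (hκ : 0 < κ) :
    c2mRoot κ ((√κ - 1) / (√κ + 1)) = (√κ - 1) / (√κ + 1) := by
  obtain ⟨s, hs⟩ : ∃ s, s = √κ := ⟨_, rfl⟩
  have hs0 : 0 < s := by rw [hs]; positivity
  have hk : κ = s ^ 2 := by rw [hs, Real.sq_sqrt hκ.le]
  rw [← hs, hk, c2mRoot]
  have e1 : 1 - (s - 1) / (s + 1) = 2 / (s + 1) := by field_simp; ring
  have e2 : 1 + (s - 1) / (s + 1) = 2 * s / (s + 1) := by field_simp; ring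
  rw [e1, e2]
  field_simp
  ring

/-- The critical value comes from `9 + 4√5 = (2 + √5)²`: there the rate equals the positive root of
`t² + t - 1`, where `c2mDisc_self` changes sign. -/
theorem sqrt_five_rate {κ : ℝ} (hκ : 0 < κ) :
    κ < 9 + 4 * √5 ↔
      ((√κ - 1) / (√κ + 1)) ^ 2 + (√κ - 1) / (√κ + 1) - 1 < 0 := by
  obtain ⟨s, hs⟩ : ∃ s, s = √κ := ⟨_, rfl⟩
  have hs0 : 0 < s := by rw [hs]; positivity
  have hk : κ = s ^ 2 := by rw [hs, Real.sq_sqrt hκ.le]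
  have h5 : √5 ^ 2 = 5 := Real.sq_sqrt (by norm_num)
  have h50 : 0 ≤ √5 := Real.sqrt_nonneg 5
  have e : ((s - 1) / (s + 1)) ^ 2 + (s - 1) / (s + 1) - 1
      = (s - (2 + √5)) * ((s - 2 + √5) / (s + 1) ^ 2) := by
    field_simp
    linear_combination h5
  have h2 : 2 < √5 := by nlinarith
  have hp : 0 < (s - 2 + √5) / (s + 1) ^ 2 := by
    have : 0 < s - 2 + √5 := by linarith
    positivity
  rw [← hs, e, hk]
  constructor
  · intro h
    refine mul_neg_of_neg_of_pos ?_ hp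
    have : s < 2 + √5 := lt_of_pow_lt_pow_left₀ 2 (by positivity) (by nlinarith)
    linarith
  · intro h
    have h' : s - (2 + √5) < 0 := by
      by_contra! hh
      exact absurd (mul_nonneg hh hp.le) (not_le.2 h)
    nlinarith

theorem IsC2MParameter.root_bounds {κ ρ : ℝ} (hκ : 1 ≤ κ) (hρ : ρ ∈ Set.Ioo (0 : ℝ) 1)
    (h : IsC2MParameter κ ρ) :
    1 < κ ∧ 0 < c2mRoot κ ρ ∧ c2mRoot κ ρ ≤ ρ ∧ c2mDisc ρ (c2mRoot κ ρ) < 0 := by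
  have hκ0 : 0 < κ := by linarith
  obtain ⟨h0, h1⟩ := hρ
  rcases lt_or_ge κ (9 + 4 * √5) with hk | hk
  · have hr := h.1 hk
    have hc : c2mRoot κ ρ = ρ := by rw [hr]; exact c2mRoot_sqrt hκ0
    refine ⟨lt_of_le_of_ne hκ ?_, hc.symm ▸ h0, hc.le, ?_⟩
    · rintro rfl
      simp at hr
      exact h0.ne' hr
    · rw [hc, c2mDisc_self]
      have := (sqrt_five_rate hκ0).1 hk
      rw [← hr] at this
      exact mul_neg_of_pos_of_neg (by positivity) this
  · have hmem := h.2 hk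
    have hp := c2mPoly_neg hk h1 hmem
    have h2 := two_le_mul_sq_of_le hκ0 hmem.2
    have hκ1 : 1 < κ := lt_of_lt_of_le (by nlinarith [Real.sqrt_nonneg 5]) hk
    refine ⟨hκ1, ?_, ?_, ?_⟩
    · rw [c2mRoot, sub_pos, lt_div_iff₀ (by linarith)]
      linarith
    · by_contra! hlt
      -- At `r` the root `c` equals the rate. If `c > ρ`, then `ρ < r`; the gap, negative at `ρ`,
      -- stays negative at `r`. But there the discriminant is `16 r³ (r² + r - 1) ≥ 0`, since `κ ≥ 9
      -- + 4√5`.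
      set r := (√κ - 1) / (√κ + 1) with hr
      have hs1 : 1 < √κ := by rw [Real.lt_sqrt (by norm_num)]; linarith
      have hr0 : 0 < r := div_pos (by linarith) (by linarith)
      have hr1 : r < 1 := by rw [hr, div_lt_one (by linarith)]; linarith
      have hκr : κ * (1 - r) ^ 2 = (1 + r) ^ 2 := by
        have := c2mRoot_sqrt hκ0
        rw [← hr, c2mRoot, sub_eq_iff_eq_add, div_eq_iff (by linarith)] at this
        linear_combination this
      have hgold : 0 ≤ r ^ 2 + r - 1 := not_lt.1 fun hh => not_lt.2 hk ((sqrt_five_rate hκ0).2 hh)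
      have hρr : ρ < r := by
        by_contra! hle
        rw [c2mRoot, lt_sub_iff_add_lt, lt_div_iff₀ (by linarith)] at hlt
        have : κ * (1 - ρ) ^ 2 ≤ κ * (1 - r) ^ 2 := by
          apply mul_le_mul_of_nonneg_left _ hκ0.le
          exact pow_le_pow_left₀ (by linarith) (by linarith) 2
        nlinarith
      obtain ⟨C, hC, e⟩ := c2mPoly_factor (κ := κ) h0 h1
      obtain ⟨C', hC', e'⟩ := c2mPoly_factor (κ := κ) hr0 hr1
      have c1 := hC h2
      have c2 := hC' (by rw [hκr]; nlinarith)
      have hneg : κ * (1 - 2 / c2mW ρ ^ 2) - 1 - c2mThreshold (c2mW ρ) < 0 := by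
        by_contra! hh
        have := mul_nonneg c1.le hh
        linarith
      have hgap := c2m_gap_lt hκ0 h0 hρr hr1
      have hpr : c2mPoly κ r < 0 := by
        rw [e']
        exact mul_neg_of_pos_of_neg c2 (by linarith)
      rw [c2mPoly_eq_mul_c2mDisc (by linarith), c2mRoot_sqrt hκ0, ← hr, c2mDisc_self] at hpr
      have : 0 ≤ (1 + r) ^ 2 * (16 * r ^ 3 * (r ^ 2 + r - 1)) := by positivity
      linarith
    · rw [c2mPoly_eq_mul_c2mDisc (by linarith)] at hp
      exact (pos_iff_neg_of_mul_neg hp).1 (by positivity)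

/-! ### Convex analysis: quadratic bounds, the minimizer, interpolation. -/

namespace SmoothStronglyConvexC2

variable {d : ℕ} {m L : ℝ} {f : EuclideanSpace ℝ (Fin d) → ℝ}

theorem hasDerivAt_line (hf : SmoothStronglyConvexC2 m L f) (x v : EuclideanSpace ℝ (Fin d))
    (t : ℝ) : HasDerivAt (fun s : ℝ => f (x + s • v)) (inner ℝ (∇ f (x + t • v)) v) t := by
  have h1 : HasDerivAt (fun s : ℝ => x + s • v) v t := by
    simpa using ((hasDerivAt_id t).smul_const v).const_add x
  have hd : DifferentiableAt ℝ f (x + t • v) :=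
    (hf.contDiff.differentiable (by norm_num)).differentiableAt
  have h2 := hd.hasFDerivAt.comp_hasDerivAt t h1
  rwa [← inner_gradient_left] at h2

theorem lower_bound (hf : SmoothStronglyConvexC2 m L f) (x y : EuclideanSpace ℝ (Fin d)) :
    f x + inner ℝ (∇ f x) (y - x) + m / 2 * ‖y - x‖ ^ 2 ≤ f y := by
  have h := hf.hasDerivAt_line x (y - x) 0
  rw [zero_smul, add_zero] at h
  have h' := (hasDerivAt_iff_tendsto_slope_zero.1 h).mono_left
    (nhdsWithin_mono (0 : ℝ) (t := {0}ᶜ) (s := Set.Ioi 0) (fun t ht => ht.ne'))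
  have hlim : Tendsto (fun t : ℝ => f y - f x - (1 - t) * (m / 2 * ‖y - x‖ ^ 2)) (𝓝[>] 0)
      (𝓝 (f y - f x - (1 - 0) * (m / 2 * ‖y - x‖ ^ 2))) := by
    apply tendsto_nhdsWithin_of_tendsto_nhds
    exact Continuous.tendsto (by fun_prop) 0
  have hle := le_of_tendsto_of_tendsto h' hlim (by
    filter_upwards [Ioc_mem_nhdsGT (zero_lt_one (α := ℝ))] with t ht
    have hc := hf.strongConvex.2 (Set.mem_univ y) (Set.mem_univ x) ht.1.le
      (sub_nonneg.2 ht.2) (by ring)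
    have e : t • y + (1 - t) • x = x + t • (y - x) := by module
    rw [e] at hc
    simp only [smul_eq_mul, zero_add, zero_smul, add_zero] at hc ⊢
    rw [inv_mul_le_iff₀ ht.1]
    linarith)
  linarith

theorem upper_bound (hf : SmoothStronglyConvexC2 m L f) (x y : EuclideanSpace ℝ (Fin d)) :
    f y ≤ f x + inner ℝ (∇ f x) (y - x) + L / 2 * ‖y - x‖ ^ 2 := by
  set v := y - x with hv
  have hder : ∀ t : ℝ, HasDerivAt
      (fun s : ℝ => f (x + s • v) - s * inner ℝ (∇ f x) v - L / 2 * ‖v‖ ^ 2 * s ^ 2)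
      (inner ℝ (∇ f (x + t • v)) v - inner ℝ (∇ f x) v - L / 2 * ‖v‖ ^ 2 * (2 * t)) t := by
    intro t
    have h1 := (hasDerivAt_id t).mul_const (inner ℝ (∇ f x) v)
    have h2 := (hasDerivAt_pow 2 t).const_mul (L / 2 * ‖v‖ ^ 2)
    exact (((hf.hasDerivAt_line x v t).fun_sub h1).fun_sub h2).congr_deriv (by simp)
  have hanti : AntitoneOn
      (fun s : ℝ => f (x + s • v) - s * inner ℝ (∇ f x) v - L / 2 * ‖v‖ ^ 2 * s ^ 2)
      (Set.Icc 0 1) := by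
    refine antitoneOn_of_hasDerivWithinAt_nonpos (convex_Icc 0 1)
      (fun t _ => (hder t).continuousAt.continuousWithinAt)
      (fun t _ => (hder t).hasDerivWithinAt) fun t ht => ?_
    rw [interior_Icc] at ht
    have h1 := hf.lipschitz_gradient (x + t • v) x
    rw [add_sub_cancel_left, norm_smul, Real.norm_of_nonneg ht.1.le] at h1
    have h2 := real_inner_le_norm (∇ f (x + t • v) - ∇ f x) v
    rw [inner_sub_left] at h2
    have h3 := mul_le_mul_of_nonneg_right h1 (norm_nonneg v)
    nlinarith
  have h := hanti (Set.left_mem_Icc.2 zero_le_one) (Set.right_mem_Icc.2 zero_le_one) zero_le_one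
  have e : x + (1 : ℝ) • v = y := by rw [hv]; module
  simp only [e] at h
  simp only [one_mul, one_pow, mul_one, zero_smul, add_zero, zero_mul, sub_zero, ne_eq,
    OfNat.ofNat_ne_zero, not_false_eq_true, zero_pow, mul_zero] at h
  linarith

theorem exists_minimizer (hf : SmoothStronglyConvexC2 m L f) (hm : 0 < m) :
    ∃ xstar, ∇ f xstar = 0 ∧ ∀ y, y ≠ xstar → f xstar < f y := by
  have hcont : Continuous f := hf.contDiff.continuous
  have hlim : Tendsto f (cocompact _) atTop := by
    have h1 : Tendsto (fun y : EuclideanSpace ℝ (Fin d) =>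
        f 0 + ‖y‖ * (m / 2 * ‖y‖ - ‖∇ f 0‖)) (cocompact _) atTop := by
      have hn := tendsto_norm_cocompact_atTop (E := EuclideanSpace ℝ (Fin d))
      refine tendsto_atTop_add_const_left _ _ (hn.atTop_mul_atTop₀ ?_)
      exact tendsto_atTop_add_const_right _ _ (hn.const_mul_atTop (by positivity))
    refine tendsto_atTop_mono (fun y => ?_) h1
    have h2 := hf.lower_bound 0 y
    rw [sub_zero] at h2
    have h3 := (abs_le.1 (abs_real_inner_le_norm (∇ f 0) y)).1
    nlinarith
  obtain ⟨x, hx⟩ := hcont.exists_forall_le hlim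
  have hg : ∇ f x = 0 := by
    have : fderiv ℝ f x = 0 := IsLocalMin.fderiv_eq_zero (Eventually.of_forall hx)
    rw [gradient, this, map_zero]
  refine ⟨x, hg, fun y hy => ?_⟩
  have h := hf.lower_bound x y
  rw [hg, inner_zero_left] at h
  have : 0 < ‖y - x‖ := norm_pos_iff.2 (sub_ne_zero.2 hy)
  have : 0 < m / 2 * ‖y - x‖ ^ 2 := by positivity
  linarith

theorem strong_monotone (hf : SmoothStronglyConvexC2 m L f) (x y : EuclideanSpace ℝ (Fin d)) :
    m * ‖x - y‖ ^ 2 ≤ inner ℝ (∇ f x - ∇ f y) (x - y) := by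
  have h1 := hf.lower_bound x y
  have h2 := hf.lower_bound y x
  rw [← neg_sub x y, inner_neg_right, norm_neg] at h1
  rw [inner_sub_left]
  linarith

/-- The interpolation inequality of smooth strongly convex functions. -/
theorem interpolation (hf : SmoothStronglyConvexC2 m L f) (hmL : m < L)
    (x y : EuclideanSpace ℝ (Fin d)) :
    f x + inner ℝ (∇ f x) (y - x) + m / 2 * ‖y - x‖ ^ 2
      + ‖∇ f y - ∇ f x - m • (y - x)‖ ^ 2 / (2 * (L - m)) ≤ f y := by
  have hl : 0 < L - m := sub_pos.2 hmL
  set w := ∇ f y - ∇ f x - m • (y - x) with hw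
  -- The minimizer of the quadratic upper bound at `y` minus the quadratic lower bound at `x`;
  -- comparing both with `f z` is sharpest here.
  set z := y - (L - m)⁻¹ • w with hz
  have h1 := hf.lower_bound x z
  have h2 := hf.upper_bound y z
  have e1 : z - x = (y - x) - (L - m)⁻¹ • w := by rw [hz]; module
  have e2 : z - y = -((L - m)⁻¹ • w) := by rw [hz]; module
  have e3 : ∇ f y = w + ∇ f x + m • (y - x) := by rw [hw]; module
  rw [e1, norm_sub_sq_real, inner_sub_right] at h1
  rw [e2, norm_neg, inner_neg_right, e3] at h2
  simp only [inner_add_left, inner_smul_left, inner_smul_right, norm_smul, mul_pow,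
    real_inner_self_eq_norm_sq, RCLike.conj_to_real, norm_inv, Real.norm_of_nonneg hl.le] at h1 h2
  have e4 : ‖w‖ ^ 2 / (2 * (L - m)) = (L - m)⁻¹ * ‖w‖ ^ 2
      - L / 2 * ((L - m)⁻¹ ^ 2 * ‖w‖ ^ 2) + m / 2 * ((L - m)⁻¹ ^ 2 * ‖w‖ ^ 2) := by
    field_simp
    ring
  rw [e4]
  linarith

end SmoothStronglyConvexC2

/-! ### The quadratic storage function. -/

/-- The supply rate of the storage function, minus its dissipation. -/
noncomputable def dissipationForm (ρ c h δ X Y Z W : ℝ) : ℝ :=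
  (X - 2 * ρ * Y + ρ ^ 2 * Z) * ((X - Y) + (ρ + c) * (Y - Z) + ρ * c * (Z - W))
    - ρ * c / 2 * ((X - Y) + 2 * h * (Y - Z) + (Z - W)) ^ 2 - δ / 2 * (Y - Z) ^ 2

/-- The quadratic part of the Lyapunov function. -/
noncomputable def storageForm (ρ c h δ X Y Z : ℝ) : ℝ :=
  dissipationForm ρ c h δ X Y Z 0 + dissipationForm ρ c h δ Y Z 0 0
    + dissipationForm ρ c h δ Z 0 0 0

/-- The coefficients for which `dissipationForm` is the increment of `storageForm`. -/
structure IsDissipationPair (ρ c h δ : ℝ) : Prop where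
  left : 4 * ρ * c * h = ρ * (1 - ρ) + c * (1 + ρ - 2 * ρ ^ 2)
  right : δ = 1 + 3 * ρ - 3 * ρ ^ 2 - ρ ^ 3 + c * (1 - 3 * ρ - 3 * ρ ^ 2 + ρ ^ 3)
    - 4 * ρ * c * h ^ 2

/-- A quadratic form in a window telescopes iff its coefficients summed along each lag vanish. Lag
three cancels by the weight `ρ * c / 2`, and the total vanishes because constants are in the kernel;
the two equations of the pair settle the rest. Padding by zeros then forces the formula for the
storage. -/
theorem IsDissipationPair.form_eq {ρ c h δ : ℝ} (H : IsDissipationPair ρ c h δ) (X Y Z W : ℝ) :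
    dissipationForm ρ c h δ X Y Z W
      = storageForm ρ c h δ X Y Z - storageForm ρ c h δ Y Z W := by
  have h1 := H.left
  have h2 := H.right
  unfold storageForm dissipationForm
  linear_combination (W ^ 2 - 2 * Z * W + Y * W) * h1 + (Z * W - W ^ 2) * h2

/-- The first equation determines `h`, and the second then gives `δ = -c2mDisc ρ c / (4ρc)`. -/
theorem exists_isDissipationPair {ρ c : ℝ} (hρ : 0 < ρ) (hc : 0 < c) (hD : c2mDisc ρ c < 0) :
    ∃ h δ, 0 < δ ∧ IsDissipationPair ρ c h δ := by
  refine ⟨(ρ * (1 - ρ) + c * (1 + ρ - 2 * ρ ^ 2)) / (4 * ρ * c), -c2mDisc ρ c / (4 * ρ * c),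
    div_pos (neg_pos.2 hD) (by positivity), ?_, ?_⟩
  · field_simp
  · unfold c2mDisc
    field_simp
    ring

/-- With zero input the supply vanishes, so the storage is nonincreasing along the free recurrence
with double root `ρ`. That trajectory tends to zero, and so does the storage; its initial value is
thus nonnegative. -/
theorem IsDissipationPair.storageForm_nonneg {ρ c h δ : ℝ} (H : IsDissipationPair ρ c h δ)
    (hρ0 : 0 < ρ) (hρ1 : ρ < 1) (hc : 0 ≤ c) (hδ : 0 ≤ δ) (X Y Z : ℝ) :
    0 ≤ storageForm ρ c h δ X Y Z := by
  have hstep : ∀ X Y Z W : ℝ, X - 2 * ρ * Y + ρ ^ 2 * Z = 0 →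
      storageForm ρ c h δ X Y Z ≤ storageForm ρ c h δ Y Z W := by
    intro X Y Z W h0
    have h1 := H.form_eq X Y Z W
    rw [dissipationForm, h0] at h1
    have : 0 ≤ ρ * c / 2 * ((X - Y) + 2 * h * (Y - Z) + (Z - W)) ^ 2 := by positivity
    have : 0 ≤ δ / 2 * (Y - Z) ^ 2 := by positivity
    linarith
  set u : ℕ → ℝ := fun n => (Y + n * (X / ρ - Y)) * ρ ^ n with hu
  have hrec : ∀ n, u (n + 2) - 2 * ρ * u (n + 1) + ρ ^ 2 * u n = 0 := by
    intro n
    simp only [hu]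
    push_cast
    ring
  have hu0 : u 0 = Y := by simp [hu]
  have hu1 : u 1 = X := by simp only [hu]; push_cast; field_simp; ring
  have hanti : Antitone fun n => storageForm ρ c h δ (u (n + 2)) (u (n + 1)) (u n) :=
    antitone_nat_of_succ_le fun n => hstep _ _ _ _ (hrec (n + 1))
  have hlim : Tendsto u atTop (𝓝 0) := by
    have h1 := (tendsto_pow_atTop_nhds_zero_of_lt_one hρ0.le hρ1).const_mul Y
    have h2 := (tendsto_self_mul_const_pow_of_lt_one hρ0.le hρ1).const_mul (X / ρ - Y)
    have h3 := h1.add h2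
    simp only [mul_zero, add_zero] at h3
    refine h3.congr fun n => ?_
    simp only [hu]
    ring
  have hcont : Continuous fun p : ℝ × ℝ × ℝ => storageForm ρ c h δ p.1 p.2.1 p.2.2 := by
    unfold storageForm dissipationForm
    fun_prop
  have hQ : Tendsto (fun n => storageForm ρ c h δ (u (n + 2)) (u (n + 1)) (u n)) atTop (𝓝 0) := by
    have h0 : storageForm ρ c h δ 0 0 0 = 0 := by unfold storageForm dissipationForm; ring
    have := (hcont.tendsto (0, 0, 0)).comp
      ((hlim.comp (tendsto_add_atTop_nat 2)).prodMk_nhds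
        ((hlim.comp (tendsto_add_atTop_nat 1)).prodMk_nhds hlim))
    rwa [h0] at this
  have h1 := hanti.le_of_tendsto hQ 0
  -- The storage sees three entries but the recurrence has order two; one extra step reaches an
  -- arbitrary `Z`.
  have h2 := hstep (u 2) (u 1) (u 0) Z (hrec 0)
  simp only [zero_add] at h1
  rw [hu0, hu1] at h1 h2
  exact h1.trans h2

/-! ### Global convergence. -/

namespace SmoothStronglyConvexC2

variable {d : ℕ} {m L : ℝ} {f : EuclideanSpace ℝ (Fin d) → ℝ}

/-- The convexity inequality between the values of `f` after subtraction of its strong convexity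
and its smoothness. -/
theorem interpolation_shifted (hf : SmoothStronglyConvexC2 m L f) (hmL : m < L)
    {xstar y z wy wz : EuclideanSpace ℝ (Fin d)} (hy : wy = ∇ f y - m • (y - xstar))
    (hz : wz = ∇ f z - m • (z - xstar)) :
    (f z - m / 2 * ‖z - xstar‖ ^ 2 - ‖wz‖ ^ 2 / (2 * (L - m)))
      - (f y - m / 2 * ‖y - xstar‖ ^ 2 - ‖wy‖ ^ 2 / (2 * (L - m)))
      ≤ inner ℝ wz ((z - xstar - (L - m)⁻¹ • wz) - (y - xstar - (L - m)⁻¹ • wy)) := by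
  have hl : 0 < L - m := sub_pos.2 hmL
  have h := hf.interpolation hmL z y
  obtain ⟨p, hp⟩ : ∃ p, p = z - xstar := ⟨_, rfl⟩
  obtain ⟨q, hq⟩ : ∃ q, q = y - xstar := ⟨_, rfl⟩
  have e1 : y - z = q - p := by rw [hp, hq]; module
  have e2 : ∇ f y - ∇ f z - m • (y - z) = wy - wz := by rw [hy, hz]; module
  have e3 : ∇ f z = wz + m • p := by rw [hz, hp]; module
  rw [e2, e1, e3, norm_sub_sq_real, norm_sub_sq_real] at h
  rw [← hp, ← hq]
  simp only [inner_add_left, inner_sub_right, inner_smul_left, inner_smul_right,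
    real_inner_self_eq_norm_sq, RCLike.conj_to_real] at h ⊢
  rw [real_inner_comm p q, real_inner_comm wz wy] at h
  have e4 : ∀ t : ℝ, t / (2 * (L - m)) = (L - m)⁻¹ * t / 2 := fun t => by field_simp
  simp only [e4] at h ⊢
  linarith

/-- The energy `E` is nonnegative and drops by at least `δ / 2` times the squared increment of the
iterates. Increments therefore vanish, hence so do the gradients, and strong monotonicity brings the
query points, then the iterates, to the minimizer. -/
theorem tendsto_of_recurrence (hf : SmoothStronglyConvexC2 m L f) (hm : 0 < m) (hmL : m < L)
    {xstar : EuclideanSpace ℝ (Fin d)} (hstar : ∇ f xstar = 0) {ρ c α β η : ℝ} (hα : 0 < α)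
    (hρ0 : 0 < ρ) (hρ1 : ρ < 1) (hc : 0 < c) (hD : c2mDisc ρ c < 0)
    (hdm : β - α * m * η = ρ ^ 2) (htm : 1 + β - α * m * (1 + η) = 2 * ρ)
    (hdL : β - α * L * η = ρ * c) (htL : 1 + β - α * L * (1 + η) = -(ρ + c))
    {x : ℕ → EuclideanSpace ℝ (Fin d)}
    (hx : ∀ k, x (k + 2) = momentumStep α β η f (x (k + 1)) (x k)) :
    Tendsto x atTop (𝓝 xstar) := by
  obtain ⟨h, δ, hδ, H⟩ := exists_isDissipationPair hρ0 hc hD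
  have hl : 0 < L - m := sub_pos.2 hmL
  set e : ℕ → EuclideanSpace ℝ (Fin d) := fun k => x k - xstar with he
  set y : ℕ → EuclideanSpace ℝ (Fin d) := fun k => x (k + 1) + η • (x (k + 1) - x k) with hy
  set w : ℕ → EuclideanSpace ℝ (Fin d) := fun k => ∇ f (y k) - m • (y k - xstar) with hw
  set v : ℕ → EuclideanSpace ℝ (Fin d) := fun k => y k - xstar - (L - m)⁻¹ • w k with hv
  have hye : ∀ k, y k - xstar = (1 + η) • e (k + 1) - η • e k := fun k => by
    simp only [hy, he]; module
  have hge : ∀ k, α • ∇ f (y k) = (1 + β) • e (k + 1) - β • e k - e (k + 2) := fun k => by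
    simp only [he, hx k, momentumStep, hy]; module
  have hwe : ∀ k, -(α • w k) = e (k + 2) - (2 * ρ) • e (k + 1) + ρ ^ 2 • e k := fun k => by
    have : -(α • w k) = (α * m) • (y k - xstar) - α • ∇ f (y k) := by simp only [hw]; module
    rw [this, hge, hye, ← hdm, ← htm]
    module
  have hve : ∀ k, (α * (L - m)) • v k = e (k + 2) + (ρ + c) • e (k + 1) + (ρ * c) • e k :=
    fun k => by
    have : (α * (L - m)) • v k = (α * L) • (y k - xstar) - α • ∇ f (y k) := by
      have h1 : (α * (L - m)) • v k = (α * (L - m)) • (y k - xstar) - α • w k := by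
        simp only [hv, smul_sub, smul_smul]
        rw [mul_assoc, mul_inv_cancel₀ hl.ne', mul_one]
      rw [h1]; simp only [hw]; module
    rw [this, hge, hye, ← hdL, ← neg_eq_iff_eq_neg.2 htL]
    module
  set Hh : ℕ → ℝ := fun k =>
    f (y k) - m / 2 * ‖y k - xstar‖ ^ 2 - ‖w k‖ ^ 2 / (2 * (L - m)) - f xstar with hH
  have hH0 : ∀ k, 0 ≤ Hh k := fun k => by
    have := hf.interpolation hmL xstar (y k)
    rw [hstar, inner_zero_left, sub_zero] at this
    simp only [hH, hw]
    linarith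
  have hHstep : ∀ k, Hh (k + 1) - Hh k ≤ inner ℝ (w (k + 1)) (v (k + 1) - v k) := fun k => by
    have := hf.interpolation_shifted hmL (xstar := xstar) (y := y k) (z := y (k + 1))
      (wy := w k) (wz := w (k + 1)) rfl rfl
    simp only [hH, hv]
    linarith
  set Q : ℕ → ℝ := fun k => ∑ i, storageForm ρ c h δ (e (k + 2) i) (e (k + 1) i) (e k i) with hQ
  have hQ0 : ∀ k, 0 ≤ Q k := fun k =>
    Finset.sum_nonneg fun i _ => H.storageForm_nonneg hρ0 hρ1 hc.le hδ.le _ _ _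
  -- The weight `α² (L - m)` is the product of the scalings in `hwe` and `hve`, which make both
  -- factors those of `dissipationForm`, coordinate by coordinate.
  have hsupply : ∀ k, α ^ 2 * (L - m) * inner ℝ (w (k + 1)) (v (k + 1) - v k)
      ≤ Q k - Q (k + 1) - δ / 2 * ‖e (k + 2) - e (k + 1)‖ ^ 2 := fun k => by
    have h1 : α ^ 2 * (L - m) * inner ℝ (w (k + 1)) (v (k + 1) - v k)
        = - inner ℝ (-(α • w (k + 1))) ((α * (L - m)) • v (k + 1) - (α * (L - m)) • v k) := by
      rw [← smul_sub, inner_neg_left, inner_smul_left, inner_smul_right]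
      simp only [RCLike.conj_to_real]
      ring
    rw [h1, hwe, hve, hve, EuclideanSpace.real_norm_sq_eq, PiLp.inner_apply, Finset.mul_sum,
      ← Finset.sum_sub_distrib, ← Finset.sum_sub_distrib, ← Finset.sum_neg_distrib]
    refine Finset.sum_le_sum fun i _ => ?_
    have h2 := H.form_eq (e (k + 3) i) (e (k + 2) i) (e (k + 1) i) (e k i)
    unfold dissipationForm at h2
    have h3 : 0 ≤ ρ * c / 2 * ((e (k + 3) i - e (k + 2) i) + 2 * h * (e (k + 2) i - e (k + 1) i)
      + (e (k + 1) i - e k i)) ^ 2 := by positivity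
    simp only [PiLp.add_apply, PiLp.sub_apply, PiLp.smul_apply, smul_eq_mul,
      RCLike.inner_apply, conj_trivial, add_assoc, Nat.reduceAdd] at h2 h3 ⊢
    nlinarith
  set E : ℕ → ℝ := fun k => α ^ 2 * (L - m) * Hh k + Q k with hE
  have hE0 : ∀ k, 0 ≤ E k := fun k =>
    add_nonneg (mul_nonneg (by positivity) (hH0 k)) (hQ0 k)
  have hEstep : ∀ k, δ / 2 * ‖e (k + 2) - e (k + 1)‖ ^ 2 ≤ E k - E (k + 1) := fun k => by
    have h1 := mul_le_mul_of_nonneg_left (hHstep k) (by positivity : 0 ≤ α ^ 2 * (L - m))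
    have h2 := hsupply k
    simp only [hE]
    linarith
  have hEanti : Antitone E := antitone_nat_of_succ_le fun k => by
    have : 0 ≤ δ / 2 * ‖e (k + 2) - e (k + 1)‖ ^ 2 := by positivity
    linarith [hEstep k]
  have hElim := tendsto_atTop_ciInf hEanti ⟨0, by rintro _ ⟨k, rfl⟩; exact hE0 k⟩
  have hdiff : Tendsto (fun k => E k - E (k + 1)) atTop (𝓝 0) := by
    simpa using hElim.sub (hElim.comp (tendsto_add_atTop_nat 1))
  have hΔ : Tendsto (fun k => e (k + 2) - e (k + 1)) atTop (𝓝 0) := by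
    have h1 : Tendsto (fun k => δ / 2 * ‖e (k + 2) - e (k + 1)‖ ^ 2) atTop (𝓝 0) :=
      squeeze_zero (fun k => by positivity) hEstep hdiff
    have h2 := h1.const_mul (2 / δ)
    rw [mul_zero] at h2
    have h3 : Tendsto (fun k => √(‖e (k + 2) - e (k + 1)‖ ^ 2)) atTop (𝓝 √0) :=
      (Real.continuous_sqrt.tendsto 0).comp (h2.congr fun k => by field_simp)
    rw [tendsto_zero_iff_norm_tendsto_zero]
    simpa [Real.sqrt_sq] using h3
  have hΔ' := hΔ.comp (tendsto_add_atTop_nat 1)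
  have hg : Tendsto (fun k => ∇ f (y (k + 1))) atTop (𝓝 0) := by
    have h1 := ((hΔ.const_smul β).sub hΔ').const_smul α⁻¹
    simp only [smul_zero, sub_zero] at h1
    refine h1.congr fun k => ?_
    rw [inv_smul_eq_iff₀ hα.ne', hge]
    simp only [Function.comp, add_assoc, Nat.reduceAdd]
    module
  have hyl : Tendsto (fun k => y (k + 1) - xstar) atTop (𝓝 0) := by
    have h1 := (tendsto_zero_iff_norm_tendsto_zero.1 hg).const_mul m⁻¹
    rw [mul_zero] at h1
    refine squeeze_zero_norm (fun k => ?_) h1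
    have h2 := hf.strong_monotone (y (k + 1)) xstar
    rw [hstar, sub_zero] at h2
    have h3 := h2.trans (real_inner_le_norm _ _)
    rw [← div_eq_inv_mul, le_div_iff₀ hm]
    rcases (norm_nonneg (y (k + 1) - xstar)).eq_or_lt with h0 | h0
    · rw [← h0, zero_mul]; exact norm_nonneg _
    · refine le_of_mul_le_mul_right ?_ h0
      linarith
  have hfin : Tendsto (fun k => x (k + 2)) atTop (𝓝 xstar) := by
    have h1 := (hyl.sub (hΔ.const_smul η)).add_const xstar
    rw [smul_zero, sub_zero, zero_add] at h1
    refine h1.congr fun k => ?_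
    simp only [hy, he, add_assoc, Nat.reduceAdd]
    module
  exact (tendsto_add_atTop_iff_nat 2).1 hfin

end SmoothStronglyConvexC2

/-! ### The local rate. -/

/-- A quadratic Lyapunov function of a second-order scalar recurrence with perturbation, whose
characteristic roots lie in the open disc of radius `σ`. -/
theorem exists_quadratic_lyapunov {σ τ D : ℝ} (hσ : 0 < σ) (hD : |D| < σ ^ 2)
    (hτ : |τ| * σ < σ ^ 2 + D) :
    ∃ a b c C : ℝ, 0 ≤ C ∧ (∀ u v : ℝ, u ^ 2 + v ^ 2 ≤ a * u ^ 2 + 2 * b * u * v + c * v ^ 2) ∧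
      ∀ u v r : ℝ, a * (τ * u - D * v + r) ^ 2 + 2 * b * (τ * u - D * v + r) * u + c * u ^ 2
        ≤ σ ^ 2 * (a * u ^ 2 + 2 * b * u * v + c * v ^ 2) - (u ^ 2 + v ^ 2) + C * r ^ 2 := by
  obtain ⟨hD1, hD2⟩ := abs_lt.1 hD
  set a := σ ^ 2 + D with ha
  have ha0 : 0 < a := by linarith
  have hdisc : 0 < a ^ 2 - σ ^ 2 * τ ^ 2 := by
    have h := pow_lt_pow_left₀ hτ (by positivity) two_ne_zero
    rw [mul_pow, sq_abs] at h
    linarith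
  have hDs : 0 < σ ^ 2 - D := by linarith
  -- With `a = σ² + D` and off-diagonal entry `-τD`, the cross term of the decrease cancels. This
  -- `ε` divides the remaining slack so that the decrease is `diag(ε / σ², ε)`.
  set ε := (σ ^ 2 - D) * (a ^ 2 - σ ^ 2 * τ ^ 2) / 2 with hε
  have hε0 : 0 < ε := by positivity
  set c := (a * D ^ 2 + ε) / σ ^ 2 with hc
  have hc0 : 0 < c := by positivity
  have hdet : 0 < a * c - (τ * D) ^ 2 := by
    have : a * c - (τ * D) ^ 2 = (D ^ 2 * (a ^ 2 - σ ^ 2 * τ ^ 2) + a * ε) / σ ^ 2 := by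
      rw [hc]; field_simp; ring
    rw [this]; positivity
  set μ := (a * c - (τ * D) ^ 2) / (a + c) with hμ
  have hμ0 : 0 < μ := by positivity
  have hlow : ∀ u v : ℝ, μ * (u ^ 2 + v ^ 2) ≤ a * u ^ 2 + 2 * (-(τ * D)) * u * v + c * v ^ 2 := by
    intro u v
    rw [hμ, div_mul_eq_mul_div, div_le_iff₀ (by positivity)]
    nlinarith [sq_nonneg (a * u - τ * D * v), sq_nonneg (c * v - τ * D * u)]
  set ν := min ε (ε / σ ^ 2) with hν
  have hν0 : 0 < ν := lt_min hε0 (by positivity)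
  have hdec : ∀ u v : ℝ, a * (τ * u - D * v) ^ 2 + 2 * (-(τ * D)) * (τ * u - D * v) * u + c * u ^ 2
      + ν * (u ^ 2 + v ^ 2) ≤ σ ^ 2 * (a * u ^ 2 + 2 * (-(τ * D)) * u * v + c * v ^ 2) := by
    intro u v
    have e : σ ^ 2 * (a * u ^ 2 + 2 * (-(τ * D)) * u * v + c * v ^ 2)
        - (a * (τ * u - D * v) ^ 2 + 2 * (-(τ * D)) * (τ * u - D * v) * u + c * u ^ 2)
        = ε / σ ^ 2 * u ^ 2 + ε * v ^ 2 := by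
      rw [hc, hε, ha]; field_simp; ring
    have h1 := mul_le_mul_of_nonneg_right (min_le_left ε (ε / σ ^ 2)) (sq_nonneg v)
    have h2 := mul_le_mul_of_nonneg_right (min_le_right ε (ε / σ ^ 2)) (sq_nonneg u)
    rw [← hν] at h1 h2
    linarith
  set p := a * τ - τ * D with hp
  set q := -(a * D) with hq
  have hpert : ∀ u v r : ℝ, 2 * r * (p * u + q * v)
      ≤ ν / 2 * (u ^ 2 + v ^ 2) + 2 / ν * (p ^ 2 + q ^ 2) * r ^ 2 := by
    intro u v r
    have e : ν / 2 * (u ^ 2 + v ^ 2) + 2 / ν * (p ^ 2 + q ^ 2) * r ^ 2 - 2 * r * (p * u + q * v)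
        = ((ν * u - 2 * p * r) ^ 2 + (ν * v - 2 * q * r) ^ 2) / (2 * ν) := by
      field_simp; ring
    have : 0 ≤ ((ν * u - 2 * p * r) ^ 2 + (ν * v - 2 * q * r) ^ 2) / (2 * ν) := by positivity
    linarith
  -- Rescaling normalizes both the lower bound and the half of the decrease that survives the
  -- perturbation.
  set S := 1 / μ + 2 / ν with hS
  have hS0 : 0 < S := by positivity
  have hSμ : 1 ≤ S * μ := by
    have : S * μ = 1 + 2 / ν * μ := by rw [hS]; field_simp
    rw [this]
    linarith [show 0 < 2 / ν * μ by positivity]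
  have hSν : 1 ≤ S * (ν / 2) := by
    have : S * (ν / 2) = 1 + 1 / μ * (ν / 2) := by rw [hS]; field_simp; ring
    rw [this]
    linarith [show 0 < 1 / μ * (ν / 2) by positivity]
  refine ⟨S * a, S * (-(τ * D)), S * c, S * (a + 2 / ν * (p ^ 2 + q ^ 2)), by positivity, ?_, ?_⟩
  · intro u v
    have h1 := mul_le_mul_of_nonneg_left (hlow u v) hS0.le
    have h2 := mul_le_mul_of_nonneg_right hSμ (by positivity : 0 ≤ u ^ 2 + v ^ 2)
    linarith
  · intro u v r
    have h1 := mul_le_mul_of_nonneg_left (add_le_add (hdec u v) (hpert u v r)) hS0.le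
    have h2 := mul_le_mul_of_nonneg_right hSν (by positivity : 0 ≤ u ^ 2 + v ^ 2)
    rw [hp, hq] at h1
    rw [hp, hq]
    linarith

namespace SmoothStronglyConvexC2

variable {d : ℕ} {m L : ℝ} {f : EuclideanSpace ℝ (Fin d) → ℝ}

/-- The gradient is differentiable, and its derivative is symmetric with quadratic form between
`m` and `L`. -/
theorem exists_hessian (hf : SmoothStronglyConvexC2 m L f) (x : EuclideanSpace ℝ (Fin d)) :
    ∃ A : EuclideanSpace ℝ (Fin d) →L[ℝ] EuclideanSpace ℝ (Fin d),
      HasFDerivAt (∇ f) A x ∧ (A : EuclideanSpace ℝ (Fin d) →ₗ[ℝ] EuclideanSpace ℝ (Fin d)).IsSymmetric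
        ∧ ∀ u, m * ‖u‖ ^ 2 ≤ inner ℝ (A u) u ∧ inner ℝ (A u) u ≤ L * ‖u‖ ^ 2 := by
  have hd : DifferentiableAt ℝ (fderiv ℝ f) x :=
    ((hf.contDiff.fderiv_right (m := 1) (by norm_num)).differentiable (by norm_num)).differentiableAt
  obtain ⟨J, hJ⟩ : ∃ J : StrongDual ℝ (EuclideanSpace ℝ (Fin d)) →L[ℝ] EuclideanSpace ℝ (Fin d),
      ∀ l, J l = (InnerProductSpace.toDual ℝ (EuclideanSpace ℝ (Fin d))).symm l :=
    ⟨LinearMap.toContinuousLinearMap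
      { toFun := (InnerProductSpace.toDual ℝ (EuclideanSpace ℝ (Fin d))).symm
        map_add' := fun u v => map_add _ u v
        map_smul' := fun t u => by simp }, fun l => rfl⟩
  obtain ⟨A, hA⟩ : ∃ A, A = J.comp (fderiv ℝ (fderiv ℝ f) x) := ⟨_, rfl⟩
  have hgrad : ∇ f = J ∘ fderiv ℝ f := funext fun z => (hJ _).symm
  have hAd : HasFDerivAt (∇ f) A x := by
    rw [hgrad, hA]
    exact J.hasFDerivAt.comp x hd.hasFDerivAt
  have hAi : ∀ u v, inner ℝ (A u) v = fderiv ℝ (fderiv ℝ f) x u v := fun u v => by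
    rw [hA, ContinuousLinearMap.comp_apply, hJ, InnerProductSpace.toDual_symm_apply]
  have hsymm : IsSymmSndFDerivAt ℝ f x :=
    hf.contDiff.contDiffAt.isSymmSndFDerivAt (by simp)
  refine ⟨A, hAd, fun u v => ?_, fun u => ?_⟩
  · change inner ℝ (A u) v = inner ℝ u (A v)
    rw [hAi, real_inner_comm, hAi, hsymm.eq]
  · have hline : HasDerivAt (fun t : ℝ => x + t • u) u 0 := by
      simpa using ((hasDerivAt_id (0 : ℝ)).smul_const u).const_add x
    have h0 : HasFDerivAt (∇ f) A (x + (0 : ℝ) • u) := by simpa using hAd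
    have h1 := ((h0.comp_hasDerivAt 0 hline).inner ℝ (hasDerivAt_const (0 : ℝ) u))
    have h2 := (hasDerivAt_iff_tendsto_slope_zero.1 h1).mono_left
      (nhdsWithin_mono (0 : ℝ) (t := {0}ᶜ) (s := Set.Ioi 0) (fun t ht => ht.ne'))
    simp only [Function.comp_apply, zero_add, zero_smul, add_zero, inner_zero_right,
      ← inner_sub_left] at h2
    have hquot : ∀ t : ℝ, 0 < t → t⁻¹ • inner ℝ (∇ f (x + t • u) - ∇ f x) u
        = (t ^ 2)⁻¹ * inner ℝ (∇ f (x + t • u) - ∇ f x) (x + t • u - x) := fun t ht => by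
      rw [add_sub_cancel_left, inner_smul_right, smul_eq_mul]
      field_simp
    have hnorm : ∀ t : ℝ, 0 < t → ‖x + t • u - x‖ ^ 2 = t ^ 2 * ‖u‖ ^ 2 := fun t ht => by
      rw [add_sub_cancel_left, norm_smul, Real.norm_of_nonneg ht.le, mul_pow]
    constructor
    · refine ge_of_tendsto h2 ?_
      filter_upwards [self_mem_nhdsWithin] with t (ht : 0 < t)
      have h3 := hf.strong_monotone (x + t • u) x
      rw [hnorm t ht] at h3
      rw [hquot t ht, le_inv_mul_iff₀ (by positivity)]
      linarith
    · refine le_of_tendsto h2 ?_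
      filter_upwards [self_mem_nhdsWithin] with t (ht : 0 < t)
      have h3 := (real_inner_le_norm (∇ f (x + t • u) - ∇ f x) (x + t • u - x)).trans
        (mul_le_mul_of_nonneg_right (hf.lipschitz_gradient _ _) (norm_nonneg _))
      rw [mul_assoc, ← sq, hnorm t ht] at h3
      rw [hquot t ht, inv_mul_le_iff₀ (by positivity)]
      linarith

/-- In an eigenbasis of the Hessian the error obeys decoupled scalar recurrences with remainder `r`.
Since `r = o(‖y - xstar‖)`, the strict decrease of the summed Lyapunov functions eventually absorbs
it, leaving the factor `σ²`. -/
theorem eventually_norm_le_mul_pow (hf : SmoothStronglyConvexC2 m L f)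
    {xstar : EuclideanSpace ℝ (Fin d)} (hstar : ∇ f xstar = 0) {α β η σ : ℝ} (hσ : 0 < σ)
    (hjury : ∀ q ∈ Set.Icc m L, |β - α * q * η| < σ ^ 2 ∧
      |1 + β - α * q * (1 + η)| * σ < σ ^ 2 + (β - α * q * η))
    {x : ℕ → EuclideanSpace ℝ (Fin d)}
    (hx : ∀ k, x (k + 2) = momentumStep α β η f (x (k + 1)) (x k))
    (hlim : Tendsto x atTop (𝓝 xstar)) :
    ∃ C : ℝ, ∀ᶠ k in atTop, ‖x k - xstar‖ ≤ C * σ ^ k := by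
  obtain ⟨A, hA, hsymm, hbound⟩ := hf.exists_hessian xstar
  set b := hsymm.eigenvectorBasis (n := d) finrank_euclideanSpace_fin with hb
  set q := hsymm.eigenvalues (n := d) finrank_euclideanSpace_fin with hq
  have hAb : ∀ i, A (b i) = q i • b i := fun i =>
    hsymm.apply_eigenvectorBasis finrank_euclideanSpace_fin i
  have hqmem : ∀ i, q i ∈ Set.Icc m L := fun i => by
    have h := hbound (b i)
    rw [hAb, inner_smul_left, real_inner_self_eq_norm_sq, b.norm_eq_one] at h
    simpa using h
  have hAinner : ∀ i z, inner ℝ (b i) (A z) = q i * inner ℝ (b i) z := fun i z => by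
    have h : inner ℝ (A (b i)) z = inner ℝ (b i) (A z) := hsymm (b i) z
    rw [← h, hAb, inner_smul_left]
    simp
  choose a p c C hC hlow hdec using fun i =>
    exists_quadratic_lyapunov hσ (hjury (q i) (hqmem i)).1 (hjury (q i) (hqmem i)).2
  set e : ℕ → EuclideanSpace ℝ (Fin d) := fun k => x k - xstar with he
  set y : ℕ → EuclideanSpace ℝ (Fin d) := fun k => x (k + 1) + η • (x (k + 1) - x k) with hy
  have hye : ∀ k, y k - xstar = (1 + η) • e (k + 1) - η • e k := fun k => by
    simp only [hy, he]; module
  set r : ℕ → EuclideanSpace ℝ (Fin d) := fun k => -(α • (∇ f (y k) - A (y k - xstar))) with hr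
  have hrec : ∀ k i, inner ℝ (b i) (e (k + 2))
      = (1 + β - α * q i * (1 + η)) * inner ℝ (b i) (e (k + 1))
        - (β - α * q i * η) * inner ℝ (b i) (e k) + inner ℝ (b i) (r k) := fun k i => by
    have h1 : e (k + 2) = (1 + β) • e (k + 1) - β • e k - α • A (y k - xstar) + r k := by
      simp only [hr, he, hx k, momentumStep, hy]; module
    have h2 : ∀ u v s : EuclideanSpace ℝ (Fin d), inner ℝ (b i)
        ((1 + β) • u - β • v - α • A ((1 + η) • u - η • v) + s)
        = (1 + β - α * q i * (1 + η)) * inner ℝ (b i) u - (β - α * q i * η) * inner ℝ (b i) v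
          + inner ℝ (b i) s := fun u v s => by
      simp only [inner_add_right, inner_sub_right, inner_smul_right, hAinner]
      ring
    rw [h1, hye, h2]
  set W : ℕ → ℝ := fun k => ∑ i, (a i * inner ℝ (b i) (e (k + 1)) ^ 2
    + 2 * p i * inner ℝ (b i) (e (k + 1)) * inner ℝ (b i) (e k) + c i * inner ℝ (b i) (e k) ^ 2)
    with hW
  set Csum := ∑ i, C i with hCsum
  have hCsum0 : 0 ≤ Csum := Finset.sum_nonneg fun i _ => hC i
  have hWlow : ∀ k, ‖e (k + 1)‖ ^ 2 + ‖e k‖ ^ 2 ≤ W k := fun k => by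
    rw [← b.sum_sq_inner_right, ← b.sum_sq_inner_right, ← Finset.sum_add_distrib]
    exact Finset.sum_le_sum fun i _ => hlow i _ _
  have hWstep : ∀ k, W (k + 1) ≤ σ ^ 2 * W k - (‖e (k + 1)‖ ^ 2 + ‖e k‖ ^ 2)
      + Csum * ‖r k‖ ^ 2 := fun k => by
    rw [← b.sum_sq_inner_right, ← b.sum_sq_inner_right, ← b.sum_sq_inner_right,
      ← Finset.sum_add_distrib, Finset.mul_sum, Finset.mul_sum, ← Finset.sum_sub_distrib,
      ← Finset.sum_add_distrib]
    refine Finset.sum_le_sum fun i _ => ?_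
    have h1 := hdec i (inner ℝ (b i) (e (k + 1))) (inner ℝ (b i) (e k)) (inner ℝ (b i) (r k))
    rw [← hrec] at h1
    have h2 := mul_le_mul_of_nonneg_right
      (Finset.single_le_sum (fun j _ => hC j) (Finset.mem_univ i))
      (sq_nonneg (inner ℝ (b i) (r k)))
    exact h1.trans (by gcongr)
  have hylim : Tendsto y atTop (𝓝 xstar) := by
    have h1 := hlim.comp (tendsto_add_atTop_nat 1)
    have h2 := h1.add ((h1.sub hlim).const_smul η)
    simpa using h2
  set M := 2 * ((1 + η) ^ 2 + η ^ 2) with hM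
  set B := Csum * (α ^ 2 * M) with hB
  have hB0 : 0 ≤ B := by positivity
  have hsmall : ∀ᶠ k in atTop, Csum * ‖r k‖ ^ 2 ≤ ‖e (k + 1)‖ ^ 2 + ‖e k‖ ^ 2 := by
    -- The tolerance `1 / (1 + B)` is chosen so that `B / (1 + B)² ≤ 1`.
    have h1 := hylim.eventually
      ((hasFDerivAt_iff_isLittleO.1 hA).def (show 0 < 1 / (1 + B) by positivity))
    filter_upwards [h1] with k hk
    rw [hstar, sub_zero] at hk
    have h2 : ‖r k‖ ^ 2 ≤ α ^ 2 * ((1 / (1 + B)) ^ 2 * ‖y k - xstar‖ ^ 2) := by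
      rw [hr]
      simp only [norm_neg, norm_smul, mul_pow, Real.norm_eq_abs, sq_abs]
      rw [← mul_pow (1 / (1 + B))]
      gcongr
    have h3 : ‖y k - xstar‖ ^ 2 ≤ M * (‖e (k + 1)‖ ^ 2 + ‖e k‖ ^ 2) := by
      have h4 : ‖y k - xstar‖ ≤ |1 + η| * ‖e (k + 1)‖ + |η| * ‖e k‖ := by
        rw [hye]
        refine (norm_sub_le _ _).trans ?_
        rw [norm_smul, norm_smul, Real.norm_eq_abs, Real.norm_eq_abs]
      have h5 := pow_le_pow_left₀ (norm_nonneg _) h4 2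
      have h6 : (|1 + η| * ‖e (k + 1)‖ + |η| * ‖e k‖) ^ 2
          ≤ (|1 + η| ^ 2 + |η| ^ 2) * (‖e (k + 1)‖ ^ 2 + ‖e k‖ ^ 2) := by
        nlinarith [sq_nonneg (|1 + η| * ‖e k‖ - |η| * ‖e (k + 1)‖)]
      rw [sq_abs, sq_abs] at h6
      have h7 : 0 ≤ ((1 + η) ^ 2 + η ^ 2) * (‖e (k + 1)‖ ^ 2 + ‖e k‖ ^ 2) := by positivity
      rw [hM]
      linarith
    have h8 : B * (1 / (1 + B)) ^ 2 ≤ 1 := by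
      rw [one_div, inv_pow, ← div_eq_mul_inv, div_le_one (by positivity)]
      nlinarith
    calc Csum * ‖r k‖ ^ 2
        ≤ Csum * (α ^ 2 * ((1 / (1 + B)) ^ 2 * (M * (‖e (k + 1)‖ ^ 2 + ‖e k‖ ^ 2)))) := by
          refine mul_le_mul_of_nonneg_left (h2.trans ?_) hCsum0
          gcongr
      _ = B * (1 / (1 + B)) ^ 2 * (‖e (k + 1)‖ ^ 2 + ‖e k‖ ^ 2) := by rw [hB]; ring
      _ ≤ 1 * (‖e (k + 1)‖ ^ 2 + ‖e k‖ ^ 2) := by gcongr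
      _ = _ := one_mul _
  obtain ⟨K, hK⟩ := eventually_atTop.1 hsmall
  have hgeom : ∀ n, W (K + n) ≤ (σ ^ n) ^ 2 * W K := by
    intro n
    induction n with
    | zero => simp
    | succ n ih =>
      have h1 := hWstep (K + n)
      have h2 := hK (K + n) (by omega)
      have h3 := mul_le_mul_of_nonneg_left ih (sq_nonneg σ)
      rw [← add_assoc]
      calc W (K + n + 1) ≤ σ ^ 2 * W (K + n) := by linarith
        _ ≤ σ ^ 2 * ((σ ^ n) ^ 2 * W K) := h3
        _ = _ := by ring
  have hWK : 0 ≤ W K := le_trans (by positivity) (hWlow K)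
  refine ⟨√(W K) / σ ^ K, eventually_atTop.2 ⟨K, fun k hk => ?_⟩⟩
  obtain ⟨n, rfl⟩ := Nat.exists_eq_add_of_le hk
  have h1 : ‖e (K + n)‖ ^ 2 ≤ (σ ^ n * √(W K)) ^ 2 := by
    rw [mul_pow, Real.sq_sqrt hWK]
    exact le_trans (by linarith [hWlow (K + n), sq_nonneg ‖e (K + n + 1)‖]) (hgeom n)
  have h2 := le_of_sq_le_sq h1 (by positivity)
  refine h2.trans (le_of_eq ?_)
  rw [pow_add]
  field_simp

end SmoothStronglyConvexC2

theorem rootConvergenceFactor_le_of_eventually_le {E : Type*} [NormedAddCommGroup E] {x : ℕ → E}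
    {xstar : E} {C σ : ℝ} (hσ : 0 ≤ σ) (h : ∀ᶠ k in atTop, ‖x k - xstar‖ ≤ C * σ ^ k) :
    rootConvergenceFactor x xstar ≤ ENNReal.ofReal σ := by
  have hlim : Tendsto (fun k : ℕ => ENNReal.ofReal (max C 1 ^ (1 / (k : ℝ)) * σ)) atTop
      (𝓝 (ENNReal.ofReal σ)) := by
    have h1 : Tendsto (fun k : ℕ => max C 1 ^ (1 / (k : ℝ))) atTop (𝓝 (max C 1 ^ (0 : ℝ))) :=
      tendsto_const_nhds.rpow tendsto_one_div_atTop_nhds_zero_nat (Or.inl (by positivity))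
    have h2 := h1.mul_const σ
    rw [Real.rpow_zero, one_mul] at h2
    exact ENNReal.tendsto_ofReal h2
  refine (limsup_le_limsup ?_).trans hlim.limsup_eq.le
  filter_upwards [h, eventually_ge_atTop 1] with k hk hk1
  have hk0 : (k : ℝ) ≠ 0 := by positivity
  have h1 : ‖x k - xstar‖ ≤ max C 1 * σ ^ k :=
    hk.trans (mul_le_mul_of_nonneg_right (le_max_left _ _) (by positivity))
  rw [← ofReal_norm, ENNReal.ofReal_rpow_of_nonneg (norm_nonneg _) (by positivity)]
  apply ENNReal.ofReal_le_ofReal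
  calc ‖x k - xstar‖ ^ (1 / (k : ℝ)) ≤ (max C 1 * σ ^ k) ^ (1 / (k : ℝ)) :=
        Real.rpow_le_rpow (norm_nonneg _) h1 (by positivity)
    _ = max C 1 ^ (1 / (k : ℝ)) * σ := by
        rw [Real.mul_rpow (by positivity) (by positivity), one_div,
          Real.pow_rpow_inv_natCast hσ (by omega)]

/-- The characteristic roots of the iteration stay in the disc of radius `ρ` for all curvatures
between `m` and `L`, because the coefficients are affine in the curvature. -/
theorem jury_of_endpoints {m L ρ c α β η σ : ℝ} (hmL : m < L) (hρ : 0 < ρ) (hσ : ρ < σ)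
    (hc : 0 < c) (hcρ : c ≤ ρ)
    (hdm : β - α * m * η = ρ ^ 2) (htm : 1 + β - α * m * (1 + η) = 2 * ρ)
    (hdL : β - α * L * η = ρ * c) (htL : 1 + β - α * L * (1 + η) = -(ρ + c))
    {q : ℝ} (hq : q ∈ Set.Icc m L) :
    |β - α * q * η| < σ ^ 2 ∧ |1 + β - α * q * (1 + η)| * σ < σ ^ 2 + (β - α * q * η) := by
  have hl : 0 < L - m := sub_pos.2 hmL
  obtain ⟨t, ht0, ht1, rfl⟩ : ∃ t : ℝ, 0 ≤ t ∧ t ≤ 1 ∧ q = (1 - t) * m + t * L := by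
    refine ⟨(q - m) / (L - m), div_nonneg (by linarith [hq.1]) hl.le, ?_, ?_⟩
    · rw [div_le_one hl]; linarith [hq.2]
    · field_simp; ring
  have ed : β - α * ((1 - t) * m + t * L) * η = (1 - t) * ρ ^ 2 + t * (ρ * c) := by
    linear_combination (1 - t) * hdm + t * hdL
  have et : 1 + β - α * ((1 - t) * m + t * L) * (1 + η) = (1 - t) * (2 * ρ) - t * (ρ + c) := by
    linear_combination (1 - t) * htm + t * htL
  rw [ed, et]
  have hσ0 : 0 < σ := hρ.trans hσ
  have ht : 0 ≤ 1 - t := by linarith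
  have a1 : ρ ^ 2 < σ ^ 2 := pow_lt_pow_left₀ hσ hρ.le two_ne_zero
  have a2 : ρ * c ≤ ρ ^ 2 := by nlinarith
  have a3 : 0 < (σ - ρ) ^ 2 := pow_pos (by linarith) 2
  have a4 : 0 < (σ - ρ) * (σ - c) := mul_pos (by linarith) (by linarith)
  have a5 : 0 < ρ * c := mul_pos hρ hc
  have a6 : 0 < ρ * σ := mul_pos hρ hσ0
  have a7 : 0 < c * σ := mul_pos hc hσ0
  constructor
  · rw [abs_of_nonneg (by positivity)]
    nlinarith
  · rw [← abs_of_pos hσ0, ← abs_mul, abs_of_pos hσ0, abs_lt]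
    have b1 : 0 ≤ (1 - t) * (σ - ρ) ^ 2 := by positivity
    have b2 : 0 ≤ t * ((σ - ρ) * (σ - c)) := by positivity
    have b3 : 0 ≤ t * (c * σ + ρ * σ) := by positivity
    have b4 : 0 ≤ (1 - t) * (ρ * σ) := by positivity
    constructor
    · rcases ht0.eq_or_lt with rfl | ht'
      · nlinarith
      · have : 0 < t * ((σ - ρ) * (σ - c)) := by positivity
        nlinarith [sq_nonneg σ, sq_nonneg ρ, mul_nonneg ht (sq_nonneg σ), mul_nonneg ht (sq_nonneg ρ)]
    · rcases ht0.eq_or_lt with rfl | ht'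
      · nlinarith
      · have : 0 < t * (σ ^ 2 + ρ * c) := by positivity
        nlinarith

/-! ### Assembly. -/

theorem theorem1 (d : ℕ) (m L ρ : ℝ) (hm : 0 < m) (hmL : m ≤ L) (hρ : ρ ∈ Set.Ioo (0 : ℝ) 1)
    (hρκ : IsC2MParameter (L / m) ρ) :
    (∀ f : EuclideanSpace ℝ (Fin d) → ℝ, SmoothStronglyConvexC2 m L f →
      ∃ xstar, (∀ y, y ≠ xstar → f xstar < f y) ∧
        ∀ xinit x0 : EuclideanSpace ℝ (Fin d),
          Tendsto (momentumIterates (c2mAlpha m ρ) (c2mBeta (L / m) ρ) (c2mEta (L / m) ρ) f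
            xinit x0) atTop (𝓝 xstar)) ∧
    worstCaseRootConvergenceFactor (c2mAlpha m ρ) (c2mBeta (L / m) ρ) (c2mEta (L / m) ρ)
      {f : EuclideanSpace ℝ (Fin d) → ℝ | SmoothStronglyConvexC2 m L f} ≤ ENNReal.ofReal ρ := by
  have hκ : 1 ≤ L / m := (one_le_div hm).2 hmL
  obtain ⟨hκ1, hc, hcρ, hD⟩ := hρκ.root_bounds hκ hρ
  have hmL' : m < L := (one_lt_div hm).1 hκ1
  have hρ0 := hρ.1
  have hρ1 := hρ.2
  have hα : 0 < c2mAlpha m ρ := div_pos (pow_pos (by linarith) 2) hm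
  have hαm : c2mAlpha m ρ * m = (1 - ρ) ^ 2 := div_mul_cancel₀ _ hm.ne'
  have hαL : c2mAlpha m ρ * L = L / m * (1 - ρ) ^ 2 := by
    unfold c2mAlpha
    field_simp
  have n0 : 1 + ρ ≠ 0 := by linarith
  have n1 : 1 - ρ ≠ 0 := by linarith
  have hdm := c2m_det_left hκ1.ne' n0 n1
  have htm := c2m_trace_left hκ1.ne' n0 n1
  have hdL := c2m_det_right hκ1.ne' n0 n1
  have htL := c2m_trace_right hκ1.ne' n0 n1
  rw [← hαm] at hdm htm
  rw [← hαL] at hdL htL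
  have hlim : ∀ f : EuclideanSpace ℝ (Fin d) → ℝ, SmoothStronglyConvexC2 m L f →
      ∀ xstar, ∇ f xstar = 0 → ∀ xinit x0 : EuclideanSpace ℝ (Fin d),
        Tendsto (momentumIterates (c2mAlpha m ρ) (c2mBeta (L / m) ρ) (c2mEta (L / m) ρ) f
          xinit x0) atTop (𝓝 xstar) := fun f hf xstar hstar xinit x0 =>
    hf.tendsto_of_recurrence hm hmL' hstar hα hρ0 hρ1 hc hD hdm htm hdL htL fun _ => rfl
  refine ⟨fun f hf => ?_, sSup_le ?_⟩
  · obtain ⟨xstar, hstar, hmin⟩ := hf.exists_minimizer hm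
    exact ⟨xstar, hmin, hlim f hf xstar hstar⟩
  · rintro _ ⟨f, hf, xinit, x0, xstar, hx, rfl⟩
    obtain ⟨z, hz, -⟩ := SmoothStronglyConvexC2.exists_minimizer hf hm
    -- Global convergence identifies the limit in the supremum with the minimizer.
    obtain rfl := tendsto_nhds_unique hx (hlim f hf z hz xinit x0)
    have hσ : ∀ σ, ρ < σ → rootConvergenceFactor (momentumIterates (c2mAlpha m ρ)
        (c2mBeta (L / m) ρ) (c2mEta (L / m) ρ) f xinit x0) xstar ≤ ENNReal.ofReal σ := by
      intro σ hσ
      obtain ⟨C, hC⟩ := SmoothStronglyConvexC2.eventually_norm_le_mul_pow hf hz (hρ0.trans hσ)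
        (fun q hq => jury_of_endpoints hmL' hρ0 hσ hc hcρ hdm htm hdL htL hq) (fun _ => rfl) hx
      exact rootConvergenceFactor_le_of_eventually_le (hρ0.trans hσ).le hC
    have hcont : Tendsto ENNReal.ofReal (𝓝[>] ρ) (𝓝 (ENNReal.ofReal ρ)) :=
      (ENNReal.continuous_ofReal.tendsto ρ).mono_left nhdsWithin_le_nhds
    -- The double root at `q = m` allows only rates `σ > ρ`; the bound follows as `σ` decreases to
    -- `ρ`.
    refine ge_of_tendsto hcont ?_
    filter_upwards [self_mem_nhdsWithin] with σ hσ'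
    exact hσ σ hσ'
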